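/- Let $n\ge 0$, let $\mathcal X_0,\dots,\mathcal X_n$ be Polish spaces and $\mathcal Y_0,\dots,\mathcal Y_n$ compact Polish spaces with their Borel $\sigma$-algebras, and put $\mathcal X_{0,n}=\prod_{i=0}^n\mathcal X_i$, $\mathcal Y_{0,n}=\prod_{i=0}^n\mathcal Y_i$. Let $\mu$ be a Borel probability measure on $\mathcal X_{0,n}$ (the source). Let $\mathcal Q^{C2}$ be the set of causal reconstruction kernels, that is, of stochastic kernels $Q(dy^n\mid x^n)$ from $\mathcal X_{0,n}$ to $\mathcal Y_{0,n}$ such that for every $i\le n$ and every measurable set $F\subseteq\mathcal Y_{0,n}$ depending only on the coordinates $y_0,\dots,y_i$, the map $x^n\mapsto Q(F\mid x^n)$ is a measurable function of $(x_0,\dots,x_i)$. Equip $\mathcal Q^{C2}$ with the topology of weak convergence of the joint laws $(\mu\otimes Q)(dx^n,dy^n)=\mu(dx^n)\,Q(dy^n\mid x^n)$, that is, the coarsest topology for which $Q\mapsto\mu\otimes Q$ is continuous into the Borel probability measures on $\mathcal X_{0,n}\times\mathcal Y_{0,n}$ with the weak topology. Let $\mathbb I(\mu,Q)=\mathbb D(\mu\otimes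 Q\,\|\,\mu\otimes\nu_Q)\in[0,\infty]$ be the directed information, where $\nu_Q$ is the marginal of $\mu\otimes Q$ on $\mathcal Y_{0,n}$ and $\mathbb D$ is relative entropy. For $D\in[0,\infty)$ and a measurable $d_{0,n}:\mathcal X_{0,n}\times\mathcal Y_{0,n}\to[0,\infty]$ let $$\overrightarrow Q_{0,n}(D)=\Big\{Q\in\mathcal Q^{C2}:\int d_{0,n}\,d(\mu\otimes Q)\le D\Big\},\qquad R^c_{0,n}(D)=\inf_{Q\in\overrightarrow Q_{0,n}(D)}\mathbb I(\mu,Q).$$ Then: 1) $\mathcal Q^{C2}$ is compact. 2) If $y^n\mapsto d_{0,n}(x^n,y^n)$ is continuous for every $x^n$, then $\overrightarrow Q_{0,n}(D)$ is a closed subset of $\mathcal Q^{C2}$. 3) Under the assumption of 2), if $\overrightarrow Q_{0,n}(D)$ is non-empty, then the infimum $R^c_{0,n}(D)$ is attained: there is $Q\in\overrightarrow Q_{0,n}(D)$ with $\mathbb I(\mu,Q)=R^c_{0,n}(D)$. -/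

import Mathlib

open MeasureTheory ProbabilityTheory
open scoped NNReal ENNReal Topology

noncomputable section

namespace NonanticipativeRD

variable {n : ℕ} {X Y : Fin (n + 1) → Type*}
  [∀ i, MeasurableSpace (X i)] [∀ i, MeasurableSpace (Y i)]

/-- The set `Q^{C2}(Y_{0,n}; X_{0,n})` of causal (non-anticipative) reconstruction kernels: the
stochastic kernels `Q(dy^n | x^n)` from `X_0 × ... × X_n` to `Y_0 × ... × Y_n` satisfying the
consistency condition: if `F` is an event in the coordinates `y_0, ..., y_i`, then `Q(F | x)` is a
measurable function of `x_0, ..., x_i`.  Here `Filtration.piLE i` is the σ-algebra of cylinder sets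
with base in the coordinates `0, ..., i`. -/
structure CausalKernel (X Y : Fin (n + 1) → Type*)
    [∀ i, MeasurableSpace (X i)] [∀ i, MeasurableSpace (Y i)] where
  /-- The stochastic kernel `x^n ↦ Q(dy^n | x^n)`. -/
  kernel : Kernel (∀ i, X i) (∀ i, Y i)
  isMarkov : IsMarkovKernel kernel
  causal : ∀ (i : Fin (n + 1)) (F : Set (∀ j, Y j)),
    MeasurableSet[Filtration.piLE (X := Y) i] F →
      Measurable[Filtration.piLE (X := X) i] (fun x => kernel x F)

instance (Q : CausalKernel X Y) : IsMarkovKernel Q.kernel := Q.isMarkov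

/-- The joint law `(μ ⊗ Q)(dx^n, dy^n) = μ(dx^n) Q(dy^n | x^n)` of source and reconstruction. -/
def jointLaw (μ : Measure (∀ i, X i)) [IsProbabilityMeasure μ] (Q : CausalKernel X Y) :
    ProbabilityMeasure ((∀ i, X i) × (∀ i, Y i)) :=
  ⟨μ ⊗ₘ Q.kernel, inferInstance⟩

/-- The marginal `ν(dy^n)` of the joint law on the reconstruction space. -/
def outputLaw (μ : Measure (∀ i, X i)) [IsProbabilityMeasure μ] (Q : CausalKernel X Y) :
    Measure (∀ i, Y i) :=
  (jointLaw μ Q : Measure ((∀ i, X i) × (∀ i, Y i))).map Prod.snd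

/-- Directed information `I_{X^n → Y^n}(μ, Q) = D(μ ⊗ Q ‖ μ ⊗ ν)` for a source `μ` that is not
affected by feedback, with values in `[0, ∞]`. -/
def directedInfo (μ : Measure (∀ i, X i)) [IsProbabilityMeasure μ] (Q : CausalKernel X Y) :
    ℝ≥0∞ :=
  InformationTheory.klDiv (jointLaw μ Q : Measure ((∀ i, X i) × (∀ i, Y i)))
    (μ.prod (outputLaw μ Q))

/-- The fidelity set: causal kernels with expected distortion at most `D`. -/
def fidelitySet (μ : Measure (∀ i, X i)) [IsProbabilityMeasure μ]
    (d : (∀ i, X i) × (∀ i, Y i) → ℝ≥0∞) (D : ℝ≥0) : Set (CausalKernel X Y) :=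
  {Q | ∫⁻ p, d p ∂(jointLaw μ Q : Measure ((∀ i, X i) × (∀ i, Y i))) ≤ D}

/-- The non-anticipative rate distortion function: the infimum of directed information over the
fidelity set. -/
def rateDistortion (μ : Measure (∀ i, X i)) [IsProbabilityMeasure μ]
    (d : (∀ i, X i) × (∀ i, Y i) → ℝ≥0∞) (D : ℝ≥0) : ℝ≥0∞ :=
  ⨅ Q ∈ fidelitySet μ d D, directedInfo μ Q

/-- The topology of weak convergence on causal kernels, for the source `μ`: `Q^α → Q` iff the joint
laws `μ ⊗ Q^α` converge weakly to `μ ⊗ Q`. -/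
@[reducible] def weakTopology (μ : Measure (∀ i, X i)) [IsProbabilityMeasure μ]
    [∀ i, TopologicalSpace (X i)] [∀ i, TopologicalSpace (Y i)]
    [OpensMeasurableSpace ((∀ i, X i) × (∀ i, Y i))] : TopologicalSpace (CausalKernel X Y) :=
  TopologicalSpace.induced (jointLaw μ) inferInstance

end NonanticipativeRD

end

noncomputable section

open Filter BoundedContinuousFunction InformationTheory

namespace NonanticipativeRD

/-! ### Variational formula for relative entropy. -/

section DonskerVaradhan

variable {α : Type*} [MeasurableSpace α] {P S : Measure α} [IsFiniteMeasure P] [IsFiniteMeasure S]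

/-! All joint laws have the same first marginal `μ` on a Polish space and live over a compact `Y`,
so they lie in a weakly compact set by Prokhorov. What must be shown is that causality survives weak
limits, although it concerns events in `x` that are merely measurable. With the first marginal
fixed, weak convergence already implies convergence against integrands measurable in `x` and
continuous in `y` (`continuous_integral_eval`).

Causality up to null sets says that the past of `y` is conditionally independent of `x` given the
past of `x`. Moving the conditioning from the kernel to the event `x ∈ A` turns this into equalities
linear in the joint law, tested by such integrands (`lawOnEvent_eq_lawGivenCondProb_iff`), hence
closed. Conversely, `exists_adapted_modification` repairs an almost surely causal kernel into one
causal everywhere.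

Expected distortion is a supremum of continuous functionals by truncation, and directed information
is one by Donsker-Varadhan. Both are lower semicontinuous, so the fidelity set is closed and the
infimum is attained by compactness. -/

theorem integrable_of_measurable_of_bounded {f : α → ℝ} (hf : Measurable f) {M : ℝ}
    (hM : ∀ x, |f x| ≤ M) : Integrable f P :=
  .of_bound hf.aestronglyMeasurable M (ae_of_all _ hM)

/-- The variational expression is a lower bound for the relative entropy. -/
theorem ofReal_integral_sub_le_klDiv {f : α → ℝ} (hf : Measurable f) {M : ℝ}
    (hM : ∀ x, |f x| ≤ M) :
    ENNReal.ofReal (∫ x, f x ∂P - ∫ x, (Real.exp (f x) - 1) ∂S) ≤ klDiv P S := by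
  by_cases htop : klDiv P S = ∞
  · simp [htop]
  obtain ⟨hac, hint⟩ := klDiv_ne_top_iff.1 htop
  refine ENNReal.ofReal_le_of_le_toReal ?_
  rw [toReal_klDiv_eq_integral_klFun hac, ← integral_rnDeriv_smul hac]
  have h1 : Integrable (fun x => (P.rnDeriv S x).toReal • f x) S :=
    (integrable_rnDeriv_smul_iff hac).2 (integrable_of_measurable_of_bounded hf hM)
  have h2 : Integrable (fun x => Real.exp (f x) - 1) S := by
    refine (integrable_of_measurable_of_bounded (M := Real.exp M) hf.exp fun x => ?_).sub
      (integrable_const 1)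
    rw [Real.abs_exp]
    exact Real.exp_le_exp.2 ((le_abs_self _).trans (hM x))
  rw [← integral_sub h1 h2]
  refine integral_mono (h1.sub h2) ((integrable_klFun_rnDeriv_iff hac).2 hint) fun x => ?_
  simp only [smul_eq_mul, klFun_apply]
  set p := (P.rnDeriv S x).toReal
  -- Fenchel-Young inequality `p * f ≤ klFun p + (exp f - 1)`, from `t + 1 ≤ exp t` at `t = f - log
  -- p`.
  rcases (show 0 ≤ p from ENNReal.toReal_nonneg).eq_or_lt with hp | hp
  · rw [← hp]
    have := Real.exp_pos (f x)
    simp only [zero_mul]; linarith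
  · have h := Real.add_one_le_exp (f x - Real.log p)
    rw [Real.exp_sub, Real.exp_log hp, le_div_iff₀ hp] at h
    linarith

theorem abs_exp_sub_exp_le {a b M : ℝ} (ha : a ≤ M) (hb : b ≤ M) :
    |Real.exp a - Real.exp b| ≤ Real.exp M * |a - b| := by
  wlog h : b ≤ a generalizing a b
  · rw [abs_sub_comm, abs_sub_comm a]
    exact this hb ha (le_of_not_ge h)
  rw [abs_of_nonneg (sub_nonneg.2 (Real.exp_le_exp.2 h)), abs_of_nonneg (sub_nonneg.2 h)]
  have h1 := Real.add_one_le_exp (b - a)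
  have h2 : Real.exp b = Real.exp a * Real.exp (b - a) := by rw [← Real.exp_add]; ring_nf
  have h3 := Real.exp_le_exp.2 ha
  have h4 := Real.exp_pos a
  calc Real.exp a - Real.exp b ≤ Real.exp a * (a - b) := by rw [h2]; nlinarith
    _ ≤ Real.exp M * (a - b) := by gcongr

/-- An upper bound of the variational expression over bounded continuous functions also bounds it
over bounded measurable functions. -/
theorem integral_sub_le_of_forall_boundedContinuous [TopologicalSpace α]
    [NormalSpace α] [BorelSpace α] [(P + S).WeaklyRegular] {C : ℝ}
    (hC : ∀ f : α →ᵇ ℝ, ∫ x, f x ∂P - ∫ x, (Real.exp (f x) - 1) ∂S ≤ C)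
    {f : α → ℝ} (hf : Measurable f) {M : ℝ} (hM : ∀ x, |f x| ≤ M) :
    ∫ x, f x ∂P - ∫ x, (Real.exp (f x) - 1) ∂S ≤ C := by
  refine le_of_forall_pos_le_add fun ε hε => ?_
  -- An `L¹` error costs a factor `1` in the `P`-term and `exp M`, the Lipschitz constant of `exp`
  -- below `M`, in the `S`-term.
  have hM0 : (0 : ℝ) < 1 + Real.exp M := by positivity
  obtain ⟨g, hg, -⟩ := (integrable_of_measurable_of_bounded (P := P + S) hf
    hM).exists_boundedContinuous_integral_sub_le (div_pos hε hM0)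
  have hMabs : -|M| ≤ -M ∧ -M ≤ |M| ∧ M ≤ |M| :=
    ⟨neg_le_neg (le_abs_self M), neg_le_abs M, le_abs_self M⟩
  -- Clipping `g` to `[-M, M]`, where `f` takes its values, brings it no farther from `f`. The norm
  -- bound is `|M|` because `α` may be empty and `M` negative.
  let k : α →ᵇ ℝ := .ofNormedAddCommGroup (fun x => max (-M) (min (g x) M))
    (by fun_prop) |M| fun x => by
      rw [Real.norm_eq_abs, abs_le]
      exact ⟨le_max_of_le_left hMabs.1, max_le hMabs.2.1 ((min_le_right _ _).trans hMabs.2.2)⟩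
  have hkM : ∀ x, k x ≤ M := fun x => by
    have := abs_nonneg (f x)
    exact max_le (by linarith [hM x]) (min_le_right _ _)
  have hfM : ∀ x, f x ≤ M := fun x => (le_abs_self _).trans (hM x)
  have hfk : ∀ x, |f x - k x| ≤ ‖f x - g x‖ := fun x => by
    have h1 : f x = max (-M) (min (f x) M) := by
      rw [min_eq_left (hfM x), max_eq_right (neg_le_of_abs_le (hM x))]
    change |f x - max (-M) (min (g x) M)| ≤ |f x - g x|
    conv_lhs => rw [h1, max_comm, max_comm (-M)]
    refine (abs_max_sub_max_le_abs _ _ _).trans ((abs_min_sub_min_le_max _ _ _ _).trans ?_)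
    simp
  have hfi : ∀ Q : Measure α, IsFiniteMeasure Q → Integrable f Q := fun Q _ =>
    integrable_of_measurable_of_bounded hf hM
  have hki : ∀ Q : Measure α, IsFiniteMeasure Q → Integrable k Q := fun Q _ => k.integrable Q
  have hexp : ∀ u : α → ℝ, Measurable u → (∀ x, u x ≤ M) →
      Integrable (fun x => Real.exp (u x)) S := fun u hu huM =>
    integrable_of_measurable_of_bounded (M := Real.exp M) hu.exp fun x => by
      rw [Real.abs_exp]; exact Real.exp_le_exp.2 (huM x)
  have hfe : Integrable (fun x => Real.exp (f x) - 1) S :=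
    (hexp f hf hfM).sub (integrable_const 1)
  have hke : Integrable (fun x => Real.exp (k x) - 1) S :=
    (hexp k k.continuous.measurable hkM).sub (integrable_const 1)
  have hgi : ∀ Q : Measure α, IsFiniteMeasure Q → Integrable (fun x => ‖f x - g x‖) Q :=
    fun Q hQ => ((hfi Q hQ).sub (g.integrable Q)).norm
  rw [integral_add_measure (hgi P inferInstance) (hgi S inferInstance)] at hg
  have hP : ∫ x, f x ∂P - ∫ x, k x ∂P ≤ ∫ x, ‖f x - g x‖ ∂P := by
    rw [← integral_sub (hfi P inferInstance) (hki P inferInstance)]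
    exact integral_mono ((hfi P inferInstance).sub (hki P inferInstance)) (hgi P inferInstance)
      fun x => (le_abs_self _).trans (hfk x)
  have hS : ∫ x, (Real.exp (k x) - 1) ∂S - ∫ x, (Real.exp (f x) - 1) ∂S
      ≤ Real.exp M * ∫ x, ‖f x - g x‖ ∂S := by
    rw [← integral_sub hke hfe,
      ← integral_const_mul]
    refine integral_mono (hke.sub hfe)
      ((hgi S inferInstance).const_mul _) fun x => ?_
    have := (le_abs_self _).trans (abs_exp_sub_exp_le (hkM x) (hfM x))
    rw [abs_sub_comm] at this
    calc Real.exp (k x) - 1 - (Real.exp (f x) - 1) = Real.exp (k x) - Real.exp (f x) := by ring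
      _ ≤ _ := this
      _ ≤ _ := by gcongr; exact hfk x
  have h0P : 0 ≤ ∫ x, ‖f x - g x‖ ∂P := integral_nonneg fun _ => norm_nonneg _
  have h0S : 0 ≤ ∫ x, ‖f x - g x‖ ∂S := integral_nonneg fun _ => norm_nonneg _
  rw [le_div_iff₀ hM0] at hg
  have := hC k
  nlinarith [mul_nonneg h0P (Real.exp_pos M).le]

/-- **Donsker-Varadhan formula** for finite Borel measures, with the supremum over bounded
continuous functions. -/
theorem klDiv_eq_iSup_boundedContinuous [TopologicalSpace α]
    [NormalSpace α] [BorelSpace α] [(P + S).WeaklyRegular] :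
    klDiv P S = ⨆ f : α →ᵇ ℝ,
      ENNReal.ofReal (∫ x, f x ∂P - ∫ x, (Real.exp (f x) - 1) ∂S) := by
  refine le_antisymm ?_ (iSup_le fun f => ofReal_integral_sub_le_klDiv
    f.continuous.measurable fun x => f.norm_coe_le_norm x)
  set C := ⨆ f : α →ᵇ ℝ, ENNReal.ofReal (∫ x, f x ∂P - ∫ x, (Real.exp (f x) - 1) ∂S)
  by_cases htop : C = ∞
  · simp [htop]
  have hbd : ∀ {f : α → ℝ}, Measurable f → ∀ {M : ℝ}, (∀ x, |f x| ≤ M) →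
      ∫ x, f x ∂P - ∫ x, (Real.exp (f x) - 1) ∂S ≤ C.toReal := fun hf _ hM =>
    integral_sub_le_of_forall_boundedContinuous (fun f =>
      (ENNReal.ofReal_le_iff_le_toReal htop).1 (le_iSup (fun f : α →ᵇ ℝ =>
        ENNReal.ofReal (∫ x, f x ∂P - ∫ x, (Real.exp (f x) - 1) ∂S)) f)) hf hM
  -- On an `S`-null set `A`, the test function `N * 1_A` has value `N * P A`, unbounded in `N`
  -- unless `P A = 0`.
  have hac : P ≪ S := by
    refine .mk fun A hA hSA => ?_
    by_contra hPA
    have hr : 0 < P.real A := ENNReal.toReal_pos hPA (measure_ne_top _ _)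
    obtain ⟨N, hN⟩ := exists_nat_gt (C.toReal / P.real A)
    have h1 := hbd (f := A.indicator fun _ => (N : ℝ)) (measurable_const.indicator hA)
      (M := (N : ℝ)) fun x => by
        by_cases hx : x ∈ A <;> simp [hx]
    have h2 : ∫ x, (Real.exp (A.indicator (fun _ => (N : ℝ)) x) - 1) ∂S = 0 := by
      refine integral_eq_zero_of_ae ?_
      filter_upwards [measure_eq_zero_iff_ae_notMem.1 hSA] with x hx
      simp [hx]
    rw [h2, integral_indicator hA, setIntegral_const, smul_eq_mul, sub_zero] at h1
    rw [div_lt_iff₀ hr] at hN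
    linarith
  rw [klDiv_eq_lintegral_klFun_of_ac hac]
  set p : α → ℝ := fun x => (P.rnDeriv S x).toReal
  have hpm : Measurable p := (Measure.measurable_rnDeriv P S).ennreal_toReal
  have hp0 : ∀ x, 0 ≤ p x := fun x => ENNReal.toReal_nonneg
  -- Truncations of the density.
  let c : ℕ → α → ℝ := fun N x => max ((N + 1 : ℝ)⁻¹) (min (p x) (N + 1))
  have hcm : ∀ N, Measurable (c N) := fun N =>
    measurable_const.max (hpm.min measurable_const)
  have hN1 : ∀ N : ℕ, (1 : ℝ) ≤ N + 1 := fun N => by linarith [(N.cast_nonneg : (0 : ℝ) ≤ N)]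
  have hinv : ∀ N : ℕ, ((N : ℝ) + 1)⁻¹ ≤ 1 := fun N => inv_le_one_of_one_le₀ (hN1 N)
  have hinv0 : ∀ N : ℕ, (0 : ℝ) < ((N : ℝ) + 1)⁻¹ := fun N => by positivity
  have hc0 : ∀ N x, 0 < c N x := fun N x => lt_max_of_lt_left (hinv0 N)
  have hcu : ∀ (N : ℕ) x, c N x ≤ N + 1 := fun N x =>
    max_le ((hinv N).trans (hN1 N)) (min_le_right _ _)
  have hcl : ∀ (N : ℕ) x, ((N : ℝ) + 1)⁻¹ ≤ c N x := fun N x => le_max_left _ _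
  -- The optimal test function would be `log p`; `φ N` is the integrand for its bounded substitute
  -- `log (c N)`. It equals `klFun c + (p - c) * log c`, and truncation gives both factors of the
  -- last term the same sign, so `φ N ≥ 0` and Fatou applies.
  let φ : ℕ → α → ℝ := fun N x => p x * Real.log (c N x) - (c N x - 1)
  have hφ0 : ∀ N x, 0 ≤ φ N x := fun N x => by
    have hk := klFun_nonneg (hc0 N x).le
    rw [klFun_apply] at hk
    have : 0 ≤ (p x - c N x) * Real.log (c N x) := by
      rcases le_total (p x) ((N + 1 : ℝ)⁻¹) with h | h
      · have hc : c N x = (N + 1 : ℝ)⁻¹ := max_eq_left ((min_le_left _ _).trans h)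
        rw [hc]
        exact mul_nonneg_of_nonpos_of_nonpos (by linarith)
          (Real.log_nonpos (hinv0 N).le (hinv N))
      · rcases le_total (p x) (N + 1) with h1 | h1
        · have hc : c N x = p x := by simp only [c]; rw [min_eq_left h1, max_eq_right h]
          simp [hc]
        · have hc : c N x = N + 1 := by
            simp only [c]; rw [min_eq_right h1, max_eq_right ((hinv N).trans (hN1 N))]
          rw [hc]
          exact mul_nonneg (by linarith) (Real.log_nonneg (hN1 N))
    simp only [φ]
    nlinarith
  have hφm : ∀ N, Measurable (φ N) := fun N =>
    (hpm.mul (hcm N).log).sub ((hcm N).sub_const 1)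
  have hφC : ∀ N, ∫⁻ x, ENNReal.ofReal (φ N x) ∂S ≤ C := fun N => by
    have hb : ∀ x, |Real.log (c N x)| ≤ Real.log (N + 1) := fun x => by
      rw [abs_le, ← Real.log_inv]
      exact ⟨Real.log_le_log (hinv0 N) (hcl N x), Real.log_le_log (hc0 N x) (hcu N x)⟩
    have h1 := hbd (hcm N).log hb
    have hi1 : Integrable (fun x => p x * Real.log (c N x)) S :=
      (integrable_rnDeriv_smul_iff hac).2 (integrable_of_measurable_of_bounded (hcm N).log hb)
    have hi2 : Integrable (fun x => c N x - 1) S :=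
      (integrable_of_measurable_of_bounded (hcm N) (M := (N : ℝ) + 1) fun x => by
        rw [abs_of_pos (hc0 N x)]; exact hcu N x).sub (integrable_const 1)
    have hi : Integrable (φ N) S := hi1.sub hi2
    rw [← ofReal_integral_eq_lintegral_ofReal hi (ae_of_all _ (hφ0 N)),
      ENNReal.ofReal_le_iff_le_toReal htop]
    refine le_trans (le_of_eq ?_) h1
    rw [← integral_rnDeriv_smul hac]
    simp_rw [Real.exp_log (hc0 N _)]
    exact integral_sub hi1 hi2
  have hlim : ∀ x, Tendsto (fun N => φ N x) atTop (𝓝 (klFun (p x))) := fun x => by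
    have hclim : Tendsto (fun N => c N x) atTop (𝓝 (p x)) := by
      have hmin : (fun N : ℕ => p x) =ᶠ[atTop] fun N : ℕ => min (p x) (N + 1) := by
        filter_upwards [eventually_ge_atTop ⌈p x⌉₊] with N hN
        have : p x ≤ N := (Nat.le_ceil (p x)).trans (Nat.cast_le.2 hN)
        exact (min_eq_left (by linarith)).symm
      have := (tendsto_one_div_add_atTop_nhds_zero_nat (𝕜 := ℝ)).max
        (tendsto_const_nhds.congr' hmin)
      simpa only [one_div, max_eq_right (hp0 x)] using this
    have hlog : Tendsto (fun N => p x * Real.log (c N x)) atTop (𝓝 (p x * Real.log (p x))) := by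
      rcases (hp0 x).eq_or_lt with h | h
      · simp [← h]
      · exact (hclim.log h.ne').const_mul _
    have := hlog.sub (hclim.sub_const 1)
    rw [klFun_apply]
    convert this using 2
    ring
  calc ∫⁻ x, ENNReal.ofReal (klFun (p x)) ∂S
      = ∫⁻ x, liminf (fun N => ENNReal.ofReal (φ N x)) atTop ∂S := by
        refine lintegral_congr fun x => ?_
        exact ((ENNReal.continuous_ofReal.tendsto _).comp (hlim x)).liminf_eq.symm
    _ ≤ liminf (fun N => ∫⁻ x, ENNReal.ofReal (φ N x) ∂S) atTop :=
        lintegral_liminf_le fun N => (hφm N).ennreal_ofReal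
    _ ≤ C := liminf_le_of_le (by isBoundedDefault) fun b hb => by
        obtain ⟨N, hN⟩ := hb.exists
        exact hN.trans (hφC N)

end DonskerVaradhan

/-! ### Weak convergence with a fixed marginal, and lower semicontinuity. -/

section StableConvergence

/-- A map into `C(Y, ℝ)` with measurable evaluations is strongly measurable. -/
theorem stronglyMeasurable_of_measurable_eval {X Y : Type*} [MeasurableSpace X]
    [TopologicalSpace Y] [CompactSpace Y] [T2Space Y] [SecondCountableTopology Y] {Ψ : X → C(Y, ℝ)}
    (h : ∀ y, Measurable fun x => Ψ x y) : StronglyMeasurable Ψ := by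
  borelize C(Y, ℝ)
  -- A bound on the uniform distance can be checked on a countable dense subset of `Y`. Balls thus
  -- have measurable preimages, and they generate the Borel σ-algebra because `C(Y, ℝ)` is second
  -- countable.
  have hdist : ∀ f : C(Y, ℝ), Measurable fun x => dist (Ψ x) f := fun f => by
    refine measurable_of_Iic fun r => ?_
    rcases lt_or_ge r 0 with hr | hr
    · convert MeasurableSet.empty
      ext x
      simpa using hr.trans_le dist_nonneg
    · obtain ⟨s, hs, hsd⟩ := TopologicalSpace.exists_countable_dense Y
      have : (fun x => dist (Ψ x) f) ⁻¹' Set.Iic r = ⋂ y ∈ s, {x | dist (Ψ x y) (f y) ≤ r} := by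
        ext x
        simp only [Set.mem_preimage, Set.mem_Iic, Set.mem_iInter, Set.mem_ofPred_eq,
          ContinuousMap.dist_le hr]
        refine ⟨fun h y _ => h y, fun h y => ?_⟩
        have hcl : IsClosed {y | dist (Ψ x y) (f y) ≤ r} :=
          isClosed_le (by fun_prop) continuous_const
        exact (hcl.closure_subset_iff.2 h) (hsd y)
      rw [this]
      exact .biInter hs fun y _ => measurableSet_le ((h y).dist measurable_const) measurable_const
  have hbasis : TopologicalSpace.IsTopologicalBasis
      {V : Set C(Y, ℝ) | ∃ f r, V = Metric.ball f r} := by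
    refine TopologicalSpace.isTopologicalBasis_of_isOpen_of_nhds ?_ fun f u hf hu => ?_
    · rintro _ ⟨f, r, rfl⟩
      exact Metric.isOpen_ball
    · obtain ⟨ε, hε, hu⟩ := Metric.isOpen_iff.1 hu f hf
      exact ⟨_, ⟨f, ε, rfl⟩, Metric.mem_ball_self hε, hu⟩
  refine Measurable.stronglyMeasurable ?_
  rw [BorelSpace.measurable_eq (α := C(Y, ℝ)), hbasis.borel_eq_generateFrom]
  refine measurable_generateFrom ?_
  rintro _ ⟨f, r, rfl⟩
  exact measurableSet_lt (hdist f) measurable_const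

variable {X Y T : Type*} [MeasurableSpace X] [TopologicalSpace Y] [PolishSpace Y] [CompactSpace Y]
  [MeasurableSpace Y] [BorelSpace Y] {μ : Measure X}

/-- Joint evaluation on `C(Y, ℝ) × Y` is continuous. The marginal condition lets `Ψ`, controlled
only `μ`-almost everywhere, be pulled back to `π`. -/
theorem aestronglyMeasurable_eval {Ψ : X → C(Y, ℝ)} (hΨ : AEStronglyMeasurable Ψ μ)
    {π : Measure (X × Y)} (hπ : π.map Prod.fst = μ) :
    AEStronglyMeasurable (fun p => Ψ p.1 p.2) π := by
  subst hπ
  have h1 : AEStronglyMeasurable (fun p : X × Y => (Ψ p.1, p.2)) π :=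
    (hΨ.comp_measurable measurable_fst).prodMk measurable_snd.aestronglyMeasurable
  exact ContinuousEval.continuous_eval.comp_aestronglyMeasurable h1

theorem integrable_eval {Ψ : X → C(Y, ℝ)} (hΨ : Integrable Ψ μ)
    {π : Measure (X × Y)} (hπ : π.map Prod.fst = μ) :
    Integrable (fun p => Ψ p.1 p.2) π := by
  have h := aestronglyMeasurable_eval hΨ.1 hπ
  subst hπ
  exact (hΨ.comp_measurable measurable_fst).mono h (ae_of_all _ fun p => (Ψ p.1).norm_coe_le_norm _)

variable [TopologicalSpace X] [PolishSpace X] [BorelSpace X] [TopologicalSpace T]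
  [IsProbabilityMeasure μ] {J : T → ProbabilityMeasure (X × Y)}

/-- Weakly continuous families of joint laws with a fixed marginal on `X` are also continuous
against Carathéodory integrands. -/
theorem continuous_integral_eval (hJ : Continuous J)
    (hfst : ∀ t, (J t : Measure (X × Y)).map Prod.fst = μ)
    {Ψ : X → C(Y, ℝ)} (hΨ : Integrable Ψ μ) :
    Continuous fun t => ∫ p, Ψ p.1 p.2 ∂(J t : Measure (X × Y)) := by
  let _ := TopologicalSpace.upgradeIsCompletelyMetrizable X
  refine continuous_of_uniform_approx_of_continuous fun u hu => ?_
  obtain ⟨ε, hε, hεu⟩ := Metric.mem_uniformity_dist.1 hu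
  -- Bounded continuous maps `X → C(Y, ℝ)` are dense in Bochner `L¹(μ)`. The error `∫ ‖Ψ - G‖ ∂μ`
  -- does not depend on `t`, since the marginal is fixed, so the approximation is uniform.
  obtain ⟨G, hG, hGi⟩ := hΨ.exists_boundedContinuous_integral_sub_le (half_pos hε)
  let g : X × Y →ᵇ ℝ := .ofNormedAddCommGroup (fun p => G p.1 p.2) (by fun_prop) ‖G‖ fun p =>
    ((G p.1).norm_coe_le_norm _).trans (G.norm_coe_le_norm _)
  refine ⟨fun t => ∫ p, g p ∂(J t : Measure (X × Y)),
    (ProbabilityMeasure.continuous_integral_boundedContinuousFunction g).comp hJ,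
    fun t => hεu ?_⟩
  rw [Real.dist_eq, ← integral_sub (integrable_eval hΨ (hfst t)) (g.integrable _)]
  have hn : Integrable (fun x => ‖Ψ x - G x‖) ((J t : Measure (X × Y)).map Prod.fst) := by
    rw [hfst t]; exact (hΨ.sub hGi).norm
  calc |∫ p, Ψ p.1 p.2 - g p ∂(J t : Measure (X × Y))|
      ≤ ∫ p, |Ψ p.1 p.2 - g p| ∂(J t : Measure (X × Y)) := abs_integral_le_integral_abs
    _ ≤ ∫ p, ‖Ψ p.1 - G p.1‖ ∂(J t : Measure (X × Y)) :=
        integral_mono ((integrable_eval hΨ (hfst t)).sub (g.integrable _)).abs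
          (hn.comp_measurable measurable_fst) fun p => (Ψ p.1 - G p.1).norm_coe_le_norm p.2
    _ = ∫ x, ‖Ψ x - G x‖ ∂μ := by
        rw [← hfst t, integral_map measurable_fst.aemeasurable hn.1]
    _ < ε := by linarith

/-- For a fixed marginal on `X`, integrals of nonnegative integrands that are continuous in `y` are
lower semicontinuous in the joint law. -/
theorem lowerSemicontinuous_lintegral (hJ : Continuous J)
    (hfst : ∀ t, (J t : Measure (X × Y)).map Prod.fst = μ)
    {d : X × Y → ℝ≥0∞} (hd : Measurable d) (hdc : ∀ x, Continuous fun y => d (x, y)) :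
    LowerSemicontinuous fun t => ∫⁻ p, d p ∂(J t : Measure (X × Y)) := by
  have hne : ∀ (k : ℕ) p, min (d p) k ≠ ∞ := fun k p =>
    ne_top_of_le_ne_top (ENNReal.natCast_ne_top k) (min_le_right _ _)
  let Ψ : ℕ → X → C(Y, ℝ) := fun k x =>
    ⟨fun y => (min (d (x, y)) k).toReal, continuous_iff_continuousAt.2 fun y =>
      (ENNReal.tendsto_toReal (hne k _)).comp
        (((hdc x).min continuous_const).tendsto y)⟩
  have hΨ : ∀ k, Integrable (Ψ k) μ := fun k => by
    refine .of_bound (stronglyMeasurable_of_measurable_eval fun y => ?_).aestronglyMeasurable k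
      (ae_of_all _ fun x => (ContinuousMap.norm_le _ k.cast_nonneg).2 fun y => ?_)
    · exact ((hd.comp measurable_prodMk_right).min measurable_const).ennreal_toReal
    · change ‖(min (d (x, y)) k).toReal‖ ≤ k
      rw [Real.norm_of_nonneg ENNReal.toReal_nonneg]
      exact ENNReal.toReal_mono (ENNReal.natCast_ne_top k) (min_le_right _ _)
  have heq : ∀ t, ∫⁻ p, d p ∂(J t : Measure (X × Y))
      = ⨆ k, ENNReal.ofReal (∫ p, Ψ k p.1 p.2 ∂(J t : Measure (X × Y))) := fun t => by
    have h1 : ∀ k, ENNReal.ofReal (∫ p, Ψ k p.1 p.2 ∂(J t : Measure (X × Y)))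
        = ∫⁻ p, min (d p) k ∂(J t : Measure (X × Y)) := fun k => by
      rw [ofReal_integral_eq_lintegral_ofReal (integrable_eval (hΨ k) (hfst t))
        (ae_of_all _ fun p => ENNReal.toReal_nonneg)]
      exact lintegral_congr fun p => ENNReal.ofReal_toReal (hne k p)
    simp_rw [h1]
    rw [← lintegral_iSup (fun k => hd.min measurable_const)
      fun i j hij p => min_le_min le_rfl (Nat.cast_le.2 hij)]
    refine lintegral_congr fun p => ?_
    change d p = ⨆ k : ℕ, d p ⊓ (k : ℝ≥0∞)
    rw [← inf_iSup_eq, ENNReal.iSup_natCast, inf_top_eq]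
  simp_rw [heq]
  exact lowerSemicontinuous_iSup fun k =>
    (ENNReal.continuous_ofReal.comp (continuous_integral_eval hJ hfst (hΨ k))).lowerSemicontinuous

omit [CompactSpace Y] in
/-- The mutual information between the two coordinates is lower semicontinuous in the joint law. -/
theorem lowerSemicontinuous_klDiv_prod (hJ : Continuous J) :
    LowerSemicontinuous fun t => klDiv (J t : Measure (X × Y))
      (μ.prod ((J t : Measure (X × Y)).map Prod.snd)) := by
  let _ := TopologicalSpace.upgradeIsCompletelyMetrizable X
  let _ := TopologicalSpace.upgradeIsCompletelyMetrizable Y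
  have hprob : ∀ t, IsProbabilityMeasure ((J t : Measure (X × Y)).map Prod.snd) := fun t =>
    Measure.isProbabilityMeasure_map measurable_snd.aemeasurable
  let R : T → ProbabilityMeasure (X × Y) := fun t =>
    ProbabilityMeasure.prod ⟨μ, inferInstance⟩ ((J t).map measurable_snd.aemeasurable)
  have hR : Continuous R := by
    have h1 : Continuous fun t => (J t).map
        (measurable_snd.aemeasurable (μ := (J t : Measure (X × Y)))) :=
      (ProbabilityMeasure.continuous_map continuous_snd).comp hJ
    exact ProbabilityMeasure.continuous_prod.comp (continuous_const.prodMk h1)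
  -- Each test function gives a functional continuous in the pair `(J t, R t)`, and `R` is
  -- continuous because marginals and products are.
  simp_rw [klDiv_eq_iSup_boundedContinuous]
  refine lowerSemicontinuous_iSup fun f => ?_
  let g : X × Y →ᵇ ℝ := .ofNormedAddCommGroup (fun p => Real.exp (f p) - 1) (by fun_prop)
    (Real.exp ‖f‖ + 1) fun p => by
      refine (norm_sub_le _ _).trans ?_
      rw [Real.norm_eq_abs, Real.abs_exp, norm_one]
      gcongr
      exact (le_abs_self _).trans (f.norm_coe_le_norm p)
  have h1 : Continuous fun t => ∫ p, f p ∂(J t : Measure (X × Y)) :=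
    (ProbabilityMeasure.continuous_integral_boundedContinuousFunction f).comp hJ
  have h2 : Continuous fun t => ∫ p, g p ∂(R t : Measure (X × Y)) :=
    (ProbabilityMeasure.continuous_integral_boundedContinuousFunction g).comp hR
  exact (ENNReal.continuous_ofReal.comp (h1.sub h2)).lowerSemicontinuous

end StableConvergence

/-! ### Making an almost surely adapted kernel adapted everywhere. -/

section AdaptedModification

variable {X Y : Type*} {m : MeasurableSpace X} {𝒢 : MeasurableSpace Y} [mX : MeasurableSpace X]
  [mY : MeasurableSpace Y]

/-- The set where two Markov kernels agree on a countably generated σ-algebra `𝒢` is measurable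
with respect to any σ-algebra for which both kernels are measurable. -/
theorem exists_measurableSet_agree (h𝒢 : 𝒢 ≤ mY)
    (hc : @MeasurableSpace.CountablyGenerated Y 𝒢)
    {κ η : Kernel X Y} [IsMarkovKernel κ] [IsMarkovKernel η]
    (hκ : ∀ F, MeasurableSet[𝒢] F → Measurable[m] fun x => κ x F)
    (hη : ∀ F, MeasurableSet[𝒢] F → Measurable[m] fun x => η x F) (μ : Measure X)
    (hae : ∀ F, MeasurableSet[𝒢] F → (fun x => κ x F) =ᵐ[μ] fun x => η x F) :
    ∃ G, MeasurableSet[m] G ∧ (∀ x ∈ G, ∀ F, MeasurableSet[𝒢] F → κ x F = η x F) ∧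
      ∀ᵐ x ∂μ, x ∈ G := by
  obtain ⟨b, hb, rfl⟩ := hc
  have hbm : ∀ F ∈ generateSetAlgebra b, MeasurableSet[MeasurableSpace.generateFrom b] F :=
    fun F hF => by
      rw [← generateFrom_generateSetAlgebra_eq]
      exact MeasurableSpace.measurableSet_generateFrom hF
  have hbc := countable_generateSetAlgebra hb
  -- Agreement on a countable generating algebra, a π-system, extends to all of `𝒢`; countability
  -- makes the set measurable and of full measure.
  refine ⟨⋂ F ∈ generateSetAlgebra b, {x | κ x F = η x F},
    .biInter hbc fun F hF => measurableSet_eq_fun (hκ F (hbm F hF)) (hη F (hbm F hF)), ?_, ?_⟩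
  · intro x hx F hF
    simp only [Set.mem_iInter, Set.mem_ofPred_eq] at hx
    have h := ext_of_generate_finite (m0 := MeasurableSpace.generateFrom b)
      (μ := (κ x).trim h𝒢) (ν := (η x).trim h𝒢) (generateSetAlgebra b)
      generateFrom_generateSetAlgebra_eq.symm
      isSetAlgebra_generateSetAlgebra.isSetRing.isSetSemiring.isPiSystem
      (fun F hF => by
        rw [trim_measurableSet_eq h𝒢 (hbm F hF), trim_measurableSet_eq h𝒢 (hbm F hF)]
        exact hx F hF)
      (by rw [trim_measurableSet_eq h𝒢 .univ, trim_measurableSet_eq h𝒢 .univ]; simp)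
    rw [← trim_measurableSet_eq h𝒢 hF, h, trim_measurableSet_eq h𝒢 hF]
  · simp only [Set.mem_iInter, Set.mem_ofPred_eq]
    exact (ae_ball_iff hbc).2 fun F hF => hae F (hbm F hF)

/-- A kernel whose restriction to each `𝒢 i` has an `ℱ i`-measurable version admits a version for
which all these restrictions are simultaneously, and everywhere, `ℱ i`-measurable. -/
theorem exists_adapted_modification {ℱ : ℕ → MeasurableSpace X} (hℱ : Monotone ℱ)
    (hℱm : ∀ i, ℱ i ≤ mX) {𝒢 : ℕ → MeasurableSpace Y} (h𝒢 : Monotone 𝒢) (h𝒢m : ∀ i, 𝒢 i ≤ mY)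
    (hc : ∀ i, @MeasurableSpace.CountablyGenerated Y (𝒢 i)) {μ : Measure X} {K : Kernel X Y}
    {κ : ℕ → Kernel X Y} (hκM : ∀ i, IsMarkovKernel (κ i))
    (hκ : ∀ i F, MeasurableSet F → Measurable[ℱ i] fun x => κ i x F)
    (hae : ∀ i F, MeasurableSet[𝒢 i] F → (fun x => κ i x F) =ᵐ[μ] fun x => K x F) (N : ℕ) :
    ∃ Q : Kernel X Y, IsMarkovKernel Q ∧ (∀ F, MeasurableSet F → Measurable[ℱ N] fun x => Q x F) ∧
      (∀ i ≤ N, ∀ F, MeasurableSet[𝒢 i] F → Measurable[ℱ i] fun x => Q x F) ∧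
      ∀ F, MeasurableSet[𝒢 N] F → (fun x => Q x F) =ᵐ[μ] fun x => K x F := by
  -- Measurability of `Q` on all events, not only those of `𝒢 N`, is carried along because the next
  -- gluing needs it on all events.
  induction N with
  | zero =>
    refine ⟨κ 0, hκM 0, hκ 0, fun i hi F hF => ?_, hae 0⟩
    obtain rfl := Nat.le_zero.1 hi
    exact hκ 0 F (h𝒢m 0 F hF)
  | succ N ih =>
    obtain ⟨Q, hQM, hQ, hQi, hQae⟩ := ih
    have hle : ℱ N ≤ ℱ (N + 1) := hℱ N.le_succ
    -- Switch to `κ (N + 1)` only where it agrees with `Q` on `𝒢 N`, and keep `Q` on the null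
    -- remainder. Earlier events then keep their values at every point, so no completion of the `ℱ
    -- i` is needed.
    obtain ⟨G, hG, hGeq, hGae⟩ := exists_measurableSet_agree (h𝒢m N) (hc N)
      (m := ℱ (N + 1)) (κ := κ (N + 1)) (η := Q) (fun F hF => hκ _ F (h𝒢m N F hF))
      (fun F hF => (hQ F (h𝒢m N F hF)).mono hle le_rfl) μ
      (fun F hF => (hae (N + 1) F (h𝒢 N.le_succ F hF)).trans (hQae F hF).symm)
    classical
    have hmeas : ∀ F, MeasurableSet F → Measurable[ℱ (N + 1)]
        fun x => Kernel.piecewise (hℱm _ G hG) (κ (N + 1)) Q x F := fun F hF => by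
      simp_rw [Kernel.piecewise_apply']
      exact Measurable.ite hG (hκ _ F hF) ((hQ F hF).mono hle le_rfl)
    refine ⟨Kernel.piecewise (hℱm _ G hG) (κ (N + 1)) Q, inferInstance, hmeas,
      fun i hi F hF => ?_, fun F hF => ?_⟩
    · rcases Nat.le_succ_iff.1 hi with h | rfl
      · convert hQi i h F hF using 2 with x
        rw [Kernel.piecewise_apply']
        split_ifs with hx
        · exact hGeq x hx F (h𝒢 h F hF)
        · rfl
      · exact hmeas F (h𝒢m _ F hF)
    · filter_upwards [hae (N + 1) F hF, hGae] with x hx hxG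
      rw [Kernel.piecewise_apply', if_pos hxG, hx]

end AdaptedModification

/-! ### Causality as a closed condition on joint laws. -/

section ConditionalIndependence

variable {X Y Z : Type*} {m : MeasurableSpace X} [mX : MeasurableSpace X] [StandardBorelSpace X]
  [MeasurableSpace Y] [MeasurableSpace Z] {μ : Measure X} [IsProbabilityMeasure μ]

/-- The law of `r y` on the event `x ∈ A`, under a joint law `π`. -/
def lawOnEvent (π : Measure (X × Y)) (r : Y → Z) (A : Set X) : Measure Z :=
  (π.restrict (Prod.fst ⁻¹' A)).map fun p => r p.2

variable (m μ) in
/-- The law of `r y` under a joint law `π`, weighted by the conditional probability of `x ∈ A` given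
the σ-algebra `m`. -/
def lawGivenCondProb (π : Measure (X × Y)) (r : Y → Z) (A : Set X) : Measure Z :=
  (π.withDensity fun p => condExpKernel μ m p.1 A).map fun p => r p.2

theorem measurable_condExpKernel_of_le (hm : m ≤ mX) {A : Set X} (hA : MeasurableSet A) :
    Measurable fun x => condExpKernel μ m x A :=
  (measurable_condExpKernel hA).mono hm le_rfl

omit [StandardBorelSpace X] in
theorem lawOnEvent_compProd_apply (K : Kernel X Y) [IsMarkovKernel K] {r : Y → Z}
    (hr : Measurable r) {A : Set X} (hA : MeasurableSet A) {F : Set Z} (hF : MeasurableSet F) :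
    lawOnEvent (μ ⊗ₘ K) r A F = ∫⁻ x in A, K x (r ⁻¹' F) ∂μ := by
  have hr2 : Measurable fun p : X × Y => r p.2 := hr.comp measurable_snd
  rw [lawOnEvent, Measure.map_apply hr2 hF, Measure.restrict_apply (hr2 hF),
    ← Measure.compProd_apply_prod hA (hr hF)]
  congr 1
  ext p
  simp [and_comm]

theorem lawGivenCondProb_compProd_apply (hm : m ≤ mX) (K : Kernel X Y) [IsMarkovKernel K]
    {r : Y → Z} (hr : Measurable r) {A : Set X} (hA : MeasurableSet A)
    {F : Set Z} (hF : MeasurableSet F) :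
    lawGivenCondProb m μ (μ ⊗ₘ K) r A F =
      ∫⁻ x, condExpKernel μ m x A * K x (r ⁻¹' F) ∂μ := by
  have hr2 : Measurable fun p : X × Y => r p.2 := hr.comp measurable_snd
  have hS : MeasurableSet ((fun p : X × Y => r p.2) ⁻¹' F) := hr2 hF
  have hc : Measurable fun p : X × Y => condExpKernel μ m p.1 A :=
    (measurable_condExpKernel_of_le hm hA).comp measurable_fst
  rw [lawGivenCondProb, Measure.map_apply hr2 hF, withDensity_apply _ hS,
    ← lintegral_indicator hS, Measure.lintegral_compProd
      (hc.indicator hS)]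
  refine lintegral_congr fun x => ?_
  have : ∀ y, ((fun p : X × Y => r p.2) ⁻¹' F).indicator
      (fun p => condExpKernel μ m p.1 A) (x, y)
      = (r ⁻¹' F).indicator (fun _ => condExpKernel μ m x A) y := fun y => rfl
  simp_rw [this]
  rw [lintegral_indicator (hr hF), setLIntegral_const]

instance (π : Measure (X × Y)) [IsFiniteMeasure π] (r : Y → Z) (A : Set X) :
    IsFiniteMeasure (lawOnEvent π r A) := by
  unfold lawOnEvent; infer_instance

instance (π : Measure (X × Y)) [IsFiniteMeasure π] (r : Y → Z) (A : Set X) :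
    IsFiniteMeasure (lawGivenCondProb m μ π r A) := by
  have : IsFiniteMeasure (π.withDensity fun p => condExpKernel μ m p.1 A) := by
    refine isFiniteMeasure_withDensity (ne_top_of_le_ne_top (measure_ne_top π Set.univ) ?_)
    calc ∫⁻ p, condExpKernel μ m p.1 A ∂π ≤ ∫⁻ _, 1 ∂π := lintegral_mono fun p => prob_le_one
      _ = _ := by simp
  unfold lawGivenCondProb; infer_instance

/-- The conditional expectation is self-adjoint, tested against indicators. -/
theorem integral_condExp_indicator_mul (hm : m ≤ mX) {k : X → ℝ} (hk : Measurable k) {M : ℝ}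
    (hM : ∀ x, |k x| ≤ M) {A : Set X} (hA : MeasurableSet A) :
    ∫ x in A, (μ[k | m]) x ∂μ = ∫ x, (condExpKernel μ m x).real A * k x ∂μ := by
  have hki : Integrable k μ := integrable_of_measurable_of_bounded hk hM
  have h1 : StronglyMeasurable[m] fun x => (condExpKernel μ m x).real A :=
    (measurable_condExpKernel hA).ennreal_toReal.stronglyMeasurable
  have h2 : Integrable ((fun x => (condExpKernel μ m x).real A) * k) μ :=
    hki.bdd_mul (c := 1) (h1.mono hm).aestronglyMeasurable
      (ae_of_all _ fun x => by
        rw [Real.norm_of_nonneg measureReal_nonneg]; exact measureReal_le_one)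
  have h3 : Integrable (A.indicator (fun _ => (1 : ℝ)) * μ[k | m]) μ :=
    integrable_condExp.bdd_mul (c := 1)
      (measurable_const.indicator hA).aestronglyMeasurable
      (ae_of_all _ fun x => by by_cases hx : x ∈ A <;> simp [hx])
  have h4 : Integrable (A.indicator (fun _ => (1 : ℝ))) μ := (integrable_const 1).indicator hA
  calc ∫ x in A, (μ[k | m]) x ∂μ = ∫ x, (A.indicator (fun _ => (1 : ℝ)) * μ[k | m]) x ∂μ := by
        rw [← integral_indicator hA]
        refine integral_congr_ae (ae_of_all _ fun x => ?_)
        by_cases hx : x ∈ A <;> simp [hx]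
    _ = ∫ x, (μ[A.indicator (fun _ => (1 : ℝ)) * μ[k | m] | m]) x ∂μ := (integral_condExp hm).symm
    -- Pulling out the `m`-measurable factor, both conditional expectations are the product of those
    -- of `1_A` and `k`.
    _ = ∫ x, (μ[(fun x => (condExpKernel μ m x).real A) * k | m]) x ∂μ := by
        refine integral_congr_ae ?_
        filter_upwards [condExp_mul_of_stronglyMeasurable_right stronglyMeasurable_condExp h3 h4,
          condExp_mul_of_stronglyMeasurable_left h1 h2 hki,
          condExpKernel_ae_eq_condExp (μ := μ) hm hA] with x e1 e2 e3
        rw [e1, e2, Pi.mul_apply, Pi.mul_apply, e3]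
    _ = _ := integral_condExp hm

/-- The two laws agree for all events `A` iff `K x F` has an `m`-measurable version for all events
`F` in the σ-algebra generated by `r`. -/
theorem lawOnEvent_eq_lawGivenCondProb_iff (hm : m ≤ mX) (K : Kernel X Y) [IsMarkovKernel K]
    {r : Y → Z} (hr : Measurable r) :
    (∀ A, MeasurableSet A → lawOnEvent (μ ⊗ₘ K) r A = lawGivenCondProb m μ (μ ⊗ₘ K) r A) ↔
      ∀ F, MeasurableSet F →
        μ[fun x => (K x).real (r ⁻¹' F) | m] =ᵐ[μ] fun x => (K x).real (r ⁻¹' F) := by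
  have hk : ∀ F, MeasurableSet F → Measurable fun x => (K x).real (r ⁻¹' F) := fun F hF =>
    (K.measurable_coe (hr hF)).ennreal_toReal
  have hb : ∀ F x, |(K x).real (r ⁻¹' F)| ≤ 1 := fun F x => by
    rw [abs_of_nonneg measureReal_nonneg]; exact measureReal_le_one
  have hi : ∀ F, MeasurableSet F → Integrable (fun x => (K x).real (r ⁻¹' F)) μ := fun F hF =>
    integrable_of_measurable_of_bounded (hk F hF) (hb F)
  have hE : ∀ A, MeasurableSet A → ∀ F, MeasurableSet F →
      (lawOnEvent (μ ⊗ₘ K) r A).real F = ∫ x in A, (K x).real (r ⁻¹' F) ∂μ := fun A hA F hF => by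
    rw [measureReal_def, lawOnEvent_compProd_apply K hr hA hF]
    exact (integral_toReal (K.measurable_coe (hr hF)).aemeasurable
      (ae_of_all _ fun x => measure_lt_top _ _)).symm
  -- Self-adjointness moves the conditioning from `A` to the kernel, so equality for all `A` says
  -- that the kernel is almost surely its own conditional expectation.
  have hG : ∀ A, MeasurableSet A → ∀ F, MeasurableSet F →
      (lawGivenCondProb m μ (μ ⊗ₘ K) r A).real F =
        ∫ x in A, (μ[fun x => (K x).real (r ⁻¹' F) | m]) x ∂μ := fun A hA F hF => by
    rw [integral_condExp_indicator_mul hm (hk F hF) (hb F) hA, measureReal_def,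
      lawGivenCondProb_compProd_apply hm K hr hA hF]
    simp_rw [measureReal_def, ← ENNReal.toReal_mul]
    exact (integral_toReal
      ((measurable_condExpKernel_of_le hm hA).mul (K.measurable_coe (hr hF))).aemeasurable
      (ae_of_all _ fun x => ENNReal.mul_lt_top (measure_lt_top _ _) (measure_lt_top _ _))).symm
  constructor
  · intro h F hF
    refine integrable_condExp.ae_eq_of_forall_setIntegral_eq _ _ (hi F hF) fun A hA _ => ?_
    rw [← hE A hA F hF, ← hG A hA F hF, h A hA]
  · intro h A hA
    refine Measure.ext fun F hF => ?_
    rw [← measureReal_eq_measureReal_iff, hE A hA F hF, hG A hA F hF]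
    exact setIntegral_congr_ae hA ((h F hF).mono fun x hx _ => hx.symm)

/-- A version of `K` that is measurable in its first argument with respect to `m`. -/
theorem exists_condKernel_version (hm : m ≤ mX) (K : Kernel X Y) [IsMarkovKernel K] :
    ∃ κ : Kernel X Y, IsMarkovKernel κ ∧ (∀ F, MeasurableSet F → Measurable[m] fun x => κ x F) ∧
      ∀ F, MeasurableSet F →
        μ[fun x => (K x).real F | m] =ᵐ[μ] (fun x => (K x).real F) →
        (fun x => κ x F) =ᵐ[μ] fun x => K x F := by
  -- Averaging `K` over the regular conditional law given `m` yields `m`-measurability at every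
  -- point for all events at once. The `comap` by `id` only enlarges the source σ-algebra.
  let c : Kernel X X := (condExpKernel μ m).comap id (measurable_id'' hm)
  have hc : ∀ x, c x = condExpKernel μ m x := fun x => rfl
  have : IsMarkovKernel c := ⟨fun x => by rw [hc]; infer_instance⟩
  refine ⟨K ∘ₖ c, inferInstance, fun F hF => ?_, fun F hF h => ?_⟩
  · simp_rw [Kernel.comp_apply' _ _ _ hF, hc]
    exact (K.measurable_coe hF).lintegral_kernel (κ := condExpKernel μ m)
  · have hi : Integrable (fun x => (K x).real F) μ :=
      integrable_of_measurable_of_bounded (K.measurable_coe hF).ennreal_toReal (M := 1) fun x => by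
        rw [abs_of_nonneg measureReal_nonneg]; exact measureReal_le_one
    filter_upwards [h, condExp_ae_eq_integral_condExpKernel hm hi] with x h1 h2
    rw [← measureReal_eq_measureReal_iff, ← h1, h2, measureReal_def, Kernel.comp_apply' _ _ _ hF,
      hc]
    exact (integral_toReal (K.measurable_coe hF).aemeasurable
      (ae_of_all _ fun x => measure_lt_top _ _)).symm

/-- The condition of `lawOnEvent_eq_lawGivenCondProb_iff` is closed for weak convergence of joint
laws with fixed first marginal. -/
theorem isClosed_ofPred_lawOnEvent_eq [TopologicalSpace X] [PolishSpace X] [BorelSpace X]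
    [TopologicalSpace Y] [PolishSpace Y] [CompactSpace Y] [BorelSpace Y]
    [TopologicalSpace Z] [HasOuterApproxClosed Z] [BorelSpace Z]
    (hm : m ≤ mX) {r : Y → Z} (hr : Continuous r) {A : Set X} (hA : MeasurableSet A)
    {T : Type*} [TopologicalSpace T] {J : T → ProbabilityMeasure (X × Y)} (hJ : Continuous J)
    (hfst : ∀ t, (J t : Measure (X × Y)).map Prod.fst = μ) :
    IsClosed {t | lawOnEvent (J t : Measure (X × Y)) r A
      = lawGivenCondProb m μ (J t : Measure (X × Y)) r A} := by
  have hcm := measurable_condExpKernel_of_le (μ := μ) hm hA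
  have hcp : Measurable fun p : X × Y => condExpKernel μ m p.1 A := hcm.comp measurable_fst
  -- Tested on bounded continuous `f`, both sides become integrals of a measurable weight in `x`
  -- times `f (r y)`, the integrands of `continuous_integral_eval`.
  have key : ∀ t, (lawOnEvent (J t : Measure (X × Y)) r A
      = lawGivenCondProb m μ (J t : Measure (X × Y)) r A) ↔ ∀ f : Z →ᵇ ℝ,
        ∫ p, (A.indicator (fun _ => (1 : ℝ)) p.1 • (⟨fun y => f (r y), by fun_prop⟩ : C(Y, ℝ))) p.2
          ∂(J t : Measure (X × Y)) =
        ∫ p, ((condExpKernel μ m p.1).real A • (⟨fun y => f (r y), by fun_prop⟩ : C(Y, ℝ))) p.2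
          ∂(J t : Measure (X × Y)) := fun t => by
    have e1 : ∀ f : Z →ᵇ ℝ, ∫ z, f z ∂(lawOnEvent (J t : Measure (X × Y)) r A) =
        ∫ p, (A.indicator (fun _ => (1 : ℝ)) p.1 • (⟨fun y => f (r y), by fun_prop⟩ : C(Y, ℝ))) p.2
          ∂(J t : Measure (X × Y)) := fun f => by
      rw [lawOnEvent, integral_map (by fun_prop) (by fun_prop),
        ← integral_indicator (measurable_fst hA)]
      refine integral_congr_ae (ae_of_all _ fun p => ?_)
      by_cases hx : p.1 ∈ A <;> simp [hx]
    have e2 : ∀ f : Z →ᵇ ℝ, ∫ z, f z ∂(lawGivenCondProb m μ (J t : Measure (X × Y)) r A) =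
        ∫ p, ((condExpKernel μ m p.1).real A • (⟨fun y => f (r y), by fun_prop⟩ : C(Y, ℝ))) p.2
          ∂(J t : Measure (X × Y)) := fun f => by
      rw [lawGivenCondProb, integral_map (by fun_prop) (by fun_prop),
        integral_withDensity_eq_integral_toReal_smul hcp
          (ae_of_all _ fun p => measure_lt_top _ _)]
      rfl
    simp_rw [← e1, ← e2]
    exact ⟨fun h f => by rw [h], ext_of_forall_integral_eq_of_IsFiniteMeasure⟩
  simp_rw [key, Set.ofPred_forall]
  refine isClosed_iInter fun f => isClosed_eq ?_ ?_
  · exact continuous_integral_eval hJ hfst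
      (((integrable_const (1 : ℝ)).indicator hA).smul_const _)
  · refine continuous_integral_eval hJ hfst (Integrable.smul_const (f := fun x =>
      (condExpKernel μ m x).real A) ?_ _)
    exact integrable_of_measurable_of_bounded (M := 1) hcm.ennreal_toReal fun x => by
      rw [abs_of_nonneg measureReal_nonneg]; exact measureReal_le_one

end ConditionalIndependence

variable {n : ℕ} {X Y : Fin (n + 1) → Type*}

/-! ### Characterisation of causal joint laws. -/

section Measurable

variable [∀ i, MeasurableSpace (X i)] [∀ i, MeasurableSpace (Y i)]
  {μ : Measure (∀ i, X i)} [IsProbabilityMeasure μ]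

theorem map_fst_jointLaw (Q : CausalKernel X Y) :
    (jointLaw μ Q : Measure ((∀ i, X i) × (∀ i, Y i))).map Prod.fst = μ :=
  Measure.fst_compProd μ Q.kernel

variable [StandardBorelSpace (∀ i, X i)]

/-- Causality makes the kernel on past events equal to its own conditional expectation. -/
theorem lawOnEvent_jointLaw (Q : CausalKernel X Y) (i : Fin (n + 1)) {A : Set (∀ i, X i)}
    (hA : MeasurableSet A) :
    lawOnEvent (jointLaw μ Q : Measure ((∀ i, X i) × (∀ i, Y i))) (Preorder.restrictLe i) A =
      lawGivenCondProb (Filtration.piLE (X := X) i) μ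
        (jointLaw μ Q : Measure ((∀ i, X i) × (∀ i, Y i))) (Preorder.restrictLe i) A := by
  refine (lawOnEvent_eq_lawGivenCondProb_iff (Filtration.piLE.le i) Q.kernel
    (Preorder.measurable_restrictLe i)).2 (fun F hF => ?_) A hA
  have hm : StronglyMeasurable[Filtration.piLE (X := X) i]
      fun x => (Q.kernel x).real (Preorder.restrictLe i ⁻¹' F) :=
    (Q.causal i _ ⟨F, hF, rfl⟩).ennreal_toReal.stronglyMeasurable
  rw [condExp_of_stronglyMeasurable (Filtration.piLE.le i) hm]
  exact integrable_of_measurable_of_bounded (hm.mono (Filtration.piLE.le i)).measurable (M := 1)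
    fun x => by rw [abs_of_nonneg measureReal_nonneg]; exact measureReal_le_one

/-- A joint law that satisfies all conditional independence relations of a causal joint law is
induced by a causal kernel. -/
theorem exists_jointLaw_eq [∀ i, StandardBorelSpace (Y i)]
    (π : ProbabilityMeasure ((∀ i, X i) × (∀ i, Y i)))
    (hπ : (π : Measure ((∀ i, X i) × (∀ i, Y i))).map Prod.fst = μ)
    (h : ∀ i A, MeasurableSet A →
      lawOnEvent (π : Measure ((∀ i, X i) × (∀ i, Y i))) (Preorder.restrictLe i) A =
      lawGivenCondProb (Filtration.piLE (X := X) i) μ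
        (π : Measure ((∀ i, X i) × (∀ i, Y i))) (Preorder.restrictLe i) A) :
    ∃ Q : CausalKernel X Y, jointLaw μ Q = π := by
  have : Nonempty (∀ i, Y i) := π.nonempty.map Prod.snd
  set K := (π : Measure ((∀ i, X i) × (∀ i, Y i))).condKernel
  have hK : μ ⊗ₘ K = π := by
    rw [← hπ]
    exact (π : Measure ((∀ i, X i) × (∀ i, Y i))).disintegrate K
  rw [← hK] at h
  have hcond := fun i => (lawOnEvent_eq_lawGivenCondProb_iff (Filtration.piLE.le i) K
    (Preorder.measurable_restrictLe i)).1 (h i)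
  -- Time is clamped at `n`, to use the induction over `ℕ`.
  let ι : ℕ → Fin (n + 1) := fun k => ⟨min k n, by omega⟩
  have hι : Monotone ι := fun a b hab => Fin.mk_le_mk.2 (min_le_min hab le_rfl)
  have hι' : ∀ i : Fin (n + 1), ι i = i := fun i =>
    Fin.ext (min_eq_left (Nat.lt_succ_iff.1 i.2))
  choose κ hκM hκ hκae using fun k : ℕ =>
    exists_condKernel_version (μ := μ) (Filtration.piLE.le (ι k)) K
  obtain ⟨Q, hQM, -, hQ, hQae⟩ := exists_adapted_modification
    (ℱ := fun k => Filtration.piLE (X := X) (ι k)) (𝒢 := fun k => Filtration.piLE (X := Y) (ι k))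
    (μ := μ) (K := K) (κ := κ)
    (fun a b hab => Filtration.piLE.mono (hι hab)) (fun k => Filtration.piLE.le _)
    (fun a b hab => Filtration.piLE.mono (hι hab)) (fun k => Filtration.piLE.le _)
    (fun k => .comap _) hκM hκ
    (by
      rintro k _ ⟨F, hF, rfl⟩
      exact hκae k _ (Preorder.measurable_restrictLe _ hF) (hcond (ι k) F hF)) n
  -- At the final time the past is the whole σ-algebra, so `Q` and `K` induce the same joint law.
  have hall : ∀ F : Set (∀ i, Y i), MeasurableSet F →
      MeasurableSet[Filtration.piLE (X := Y) (ι n)] F := fun F hF => by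
    have hle : ∀ j, j ∈ Set.Iic (ι n) := fun j =>
      Fin.le_def.2 (by simpa [ι] using Nat.lt_succ_iff.1 j.2)
    refine ⟨(fun z j => z ⟨j, hle j⟩) ⁻¹' F,
      (measurable_pi_lambda _ fun j => measurable_pi_apply _) hF, rfl⟩
  refine ⟨⟨Q, hQM, fun i F hF => ?_⟩, Subtype.ext ?_⟩
  · have := hQ i (Nat.lt_succ_iff.1 i.2) F (by rwa [hι'])
    rwa [hι'] at this
  · change μ ⊗ₘ Q = (π : Measure ((∀ i, X i) × (∀ i, Y i)))
    rw [← hK]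
    refine Measure.ext_prod fun {s t} hs ht => ?_
    rw [Measure.compProd_apply_prod hs ht, Measure.compProd_apply_prod hs ht]
    exact lintegral_congr_ae (ae_restrict_of_ae (hQae t (hall t ht)))

end Measurable

/-! ### Compactness of the set of causal joint laws. -/

section Topological

variable [∀ i, TopologicalSpace (X i)] [∀ i, PolishSpace (X i)]
  [∀ i, MeasurableSpace (X i)] [∀ i, BorelSpace (X i)]
  [∀ i, TopologicalSpace (Y i)] [∀ i, PolishSpace (Y i)] [∀ i, CompactSpace (Y i)]
  [∀ i, MeasurableSpace (Y i)] [∀ i, BorelSpace (Y i)]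
  (μ : Measure (∀ i, X i)) [IsProbabilityMeasure μ]

omit [∀ i, PolishSpace (Y i)] [∀ i, CompactSpace (Y i)] in
theorem isClosed_ofPred_map_fst_eq [∀ i, SecondCountableTopology (Y i)] :
    IsClosed {π : ProbabilityMeasure ((∀ i, X i) × (∀ i, Y i)) |
      (π : Measure ((∀ i, X i) × (∀ i, Y i))).map Prod.fst = μ} := by
  have h : Continuous fun π : ProbabilityMeasure ((∀ i, X i) × (∀ i, Y i)) =>
      π.map measurable_fst.aemeasurable := ProbabilityMeasure.continuous_map continuous_fst
  let μ' : ProbabilityMeasure (∀ i, X i) := ⟨μ, inferInstance⟩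
  have h2 : ∀ π : ProbabilityMeasure ((∀ i, X i) × (∀ i, Y i)),
      π.map measurable_fst.aemeasurable = μ' ↔
      (π : Measure ((∀ i, X i) × (∀ i, Y i))).map Prod.fst = μ := fun π => Subtype.ext_iff
  simp_rw [← h2]
  exact isClosed_eq h continuous_const

/-- Prokhorov: the single law `μ` is tight on a Polish space, and any family of laws on the compact
second factor is tight. -/
theorem isCompact_ofPred_map_fst_eq :
    IsCompact {π : ProbabilityMeasure ((∀ i, X i) × (∀ i, Y i)) |
      (π : Measure ((∀ i, X i) × (∀ i, Y i))).map Prod.fst = μ} := by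
  let _ := fun i => TopologicalSpace.upgradeIsCompletelyMetrizable (X i)
  rw [← (isClosed_ofPred_map_fst_eq μ).closure_eq]
  refine isCompact_closure_of_isTightMeasureSet (.prodMk ?_ .of_compactSpace)
  refine (isTightMeasureSet_singleton (μ := μ)).subset ?_
  rintro _ ⟨_, ⟨π, hπ, rfl⟩, rfl⟩
  exact hπ

/-- The conditional independence relations cut the range out of the compact set of laws with
marginal `μ`, and each of them is closed. -/
theorem isCompact_range_jointLaw : IsCompact (Set.range (jointLaw (Y := Y) μ)) := by
  let S := {π : ProbabilityMeasure ((∀ i, X i) × (∀ i, Y i)) |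
      (π : Measure ((∀ i, X i) × (∀ i, Y i))).map Prod.fst = μ}
  have hS : CompactSpace S := isCompact_iff_compactSpace.1 (isCompact_ofPred_map_fst_eq μ)
  let C : Set S := ⋂ (i : Fin (n + 1)) (A : {A : Set (∀ i, X i) // MeasurableSet A}),
    {π | lawOnEvent (π : Measure ((∀ i, X i) × (∀ i, Y i))) (Preorder.restrictLe i) A =
      lawGivenCondProb (Filtration.piLE (X := X) i) μ
        (π : Measure ((∀ i, X i) × (∀ i, Y i))) (Preorder.restrictLe i) A}
  have hC : IsClosed C := isClosed_iInter fun i => isClosed_iInter fun A =>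
    isClosed_ofPred_lawOnEvent_eq (Filtration.piLE.le i) (Preorder.continuous_restrictLe i) A.2
      (J := fun π : S => π.1) continuous_subtype_val fun π => π.2
  convert hC.isCompact.image continuous_subtype_val
  ext π
  simp only [C, Set.mem_range, Set.mem_image, Set.mem_iInter, Set.mem_ofPred_eq]
  constructor
  · rintro ⟨Q, rfl⟩
    exact ⟨⟨jointLaw μ Q, map_fst_jointLaw Q⟩, fun i A => lawOnEvent_jointLaw Q i A.2, rfl⟩
  · rintro ⟨⟨π, hπ⟩, h, rfl⟩
    exact exists_jointLaw_eq π hπ fun i A hA => h i ⟨A, hA⟩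

end Topological

end NonanticipativeRD

end

/-! ### Compactness, closedness and attainment. -/

theorem theorem6 {n : ℕ} {X Y : Fin (n + 1) → Type*}
    [∀ i, TopologicalSpace (X i)] [∀ i, PolishSpace (X i)]
    [∀ i, MeasurableSpace (X i)] [∀ i, BorelSpace (X i)]
    [∀ i, TopologicalSpace (Y i)] [∀ i, PolishSpace (Y i)] [∀ i, CompactSpace (Y i)]
    [∀ i, MeasurableSpace (Y i)] [∀ i, BorelSpace (Y i)]
    (μ : Measure (∀ i, X i)) [IsProbabilityMeasure μ] :
    @CompactSpace (NonanticipativeRD.CausalKernel X Y) (NonanticipativeRD.weakTopology μ) ∧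
    ∀ (d : (∀ i, X i) × (∀ i, Y i) → ℝ≥0∞) (D : ℝ≥0), Measurable d →
      (∀ x, Continuous (fun y => d (x, y))) →
        IsClosed[NonanticipativeRD.weakTopology μ]
          (NonanticipativeRD.fidelitySet (Y := Y) μ d D) ∧
        ((NonanticipativeRD.fidelitySet (Y := Y) μ d D).Nonempty →
          ∃ Q ∈ NonanticipativeRD.fidelitySet (Y := Y) μ d D,
            NonanticipativeRD.directedInfo μ Q = NonanticipativeRD.rateDistortion μ d D) := by
  let _ : TopologicalSpace (NonanticipativeRD.CausalKernel X Y) :=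
    NonanticipativeRD.weakTopology μ
  -- Inducing is all that is available: kernels equal `μ`-almost everywhere have the same joint law.
  -- Compactness still transfers from the range.
  have hJ : Topology.IsInducing (NonanticipativeRD.jointLaw (X := X) (Y := Y) μ) := ⟨rfl⟩
  have hcompact : CompactSpace (NonanticipativeRD.CausalKernel X Y) := by
    refine ⟨hJ.isCompact_iff.2 ?_⟩
    rw [Set.image_univ]
    exact NonanticipativeRD.isCompact_range_jointLaw μ
  refine ⟨hcompact, fun d D hd hdc => ?_⟩
  have hclosed : IsClosed (NonanticipativeRD.fidelitySet (Y := Y) μ d D) :=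
    (NonanticipativeRD.lowerSemicontinuous_lintegral hJ.continuous
      NonanticipativeRD.map_fst_jointLaw hd hdc).isClosed_preimage D
  refine ⟨hclosed, fun hne => ?_⟩
  have hlsc : LowerSemicontinuous (NonanticipativeRD.directedInfo (X := X) (Y := Y) μ) :=
    NonanticipativeRD.lowerSemicontinuous_klDiv_prod hJ.continuous
  obtain ⟨Q, hQ, hmin⟩ := (hlsc.lowerSemicontinuousOn _).exists_isMinOn hne hclosed.isCompact
  exact ⟨Q, hQ, le_antisymm (le_iInf₂ fun Q' hQ' => hmin hQ') (iInf₂_le Q hQ)⟩
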